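/- Let $\mathbb T^2=\mathbb R^2/\mathbb Z^2$, with Lebesgue measure $m$ (normalized so that $m(\mathbb T^2)=1$) and projection $\pi:\mathbb R^2\to\mathbb T^2$; coordinates on $\mathbb T^2$ are represented in $[0,1)$. For $\alpha>0$ let $u_\alpha$ be the velocity field on $\mathbb T^2$ that is periodic in time with period one and satisfies $$u_\alpha(t,x,y)=\bigl(0,\,-2\alpha|x-\tfrac12|\bigr)\ \text{ for } t\in[0,\tfrac12),\qquad u_\alpha(t,x,y)=\bigl(-2\alpha|y-\tfrac12|,\,0\bigr)\ \text{ for } t\in[\tfrac12,1),$$ and let $\phi_t$ be its flow map: $\phi_0(z)=z$ and $\frac{d}{dt}\phi_t(z)=u_\alpha(t,\phi_t(z))$ for $t\ge0$, the derivative being a right derivative at the times in $\frac12\mathbb Z$ at which $u_\alpha$ jumps. Let $T:\mathbb T^2\to\mathbb T^2$ be either one of the maps $$T=\phi_1^{-1}\qquad\text{or}\qquad T=T_2\circ T_1,$$ where $T_1(x,y)=(x,\,y+\alpha|x-\frac12|)\bmod 1$ and $T_2(x,y)=(x+\alpha|y-\frac12|,\,y)\bmod 1$. For a noise sequence $\xi=(\xi_1,\xi_2,\dots)\in(\mathbb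 R^2)^{\mathbb N}$ define the kicked maps $T_{\xi_i}(z)=T(z+\pi(\xi_i))$ and the iterates $T^n_\xi=T_{\xi_n}\circ\cdots\circ T_{\xi_1}$, with $T^0_\xi=\mathrm{id}$. For an integer $N\ge0$ let $\mathcal R_N$ be the set of the closed dyadic squares $[j2^{-N},(j+1)2^{-N}]\times[k2^{-N},(k+1)2^{-N}]$ in $\mathbb T^2$, where $j,k$ are integers with $0\le j,k\le 2^N-1$. There exist constants $C_0,\alpha_0\ge1$ and $\lambda\in(0,1)$ such that for every even integer $\alpha\ge\alpha_0$, for either choice of $T$, for all integers $N\ge0$ and $n\ge0$ with $n\ge C_0N$, for every $\xi\in(\mathbb R^2)^{\mathbb N}$ and for all $R,Q\in\mathcal R_N$, $$m\bigl(T^n_\xi(R)\cap Q\bigr)\ \ge\ \lambda\, m(R)\,m(Q).$$ -/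

import Mathlib

namespace KickedShear

open MeasureTheory Set

/-- The torus `𝕋² = ℝ² / ℤ²`. Its `volume` is the product of the two Haar measures of total
mass one, that is, the Lebesgue measure `m` of the torus. -/
abbrev Torus : Type := UnitAddCircle × UnitAddCircle

/-- The projection `π : ℝ² → 𝕋²`, reduction of both coordinates modulo one. -/
def proj (v : ℝ × ℝ) : Torus := ((v.1 : UnitAddCircle), (v.2 : UnitAddCircle))

/-- The function `x ↦ |x - 1/2|` on the circle, where `x` is represented in `[0, 1)`. -/
noncomputable def tent (x : UnitAddCircle) : ℝ :=
  |((AddCircle.equivIco (1 : ℝ) 0 x : ℝ)) - 1 / 2|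

/-- The horizontal shear flow `H_α(x, y) = (-2 α |y - 1/2|, 0)`. -/
noncomputable def horizontalShear (α : ℝ) (z : Torus) : ℝ × ℝ := (-2 * α * tent z.2, 0)

/-- The vertical shear flow `V_α(x, y) = (0, -2 α |x - 1/2|)`. -/
noncomputable def verticalShear (α : ℝ) (z : Torus) : ℝ × ℝ := (0, -2 * α * tent z.1)

/-- The time-periodic velocity field `u_α`, of period one: it is `V_α` for `t ∈ [0, 1/2)` and
`H_α` for `t ∈ [1/2, 1)`. -/
noncomputable def velocity (α t : ℝ) (z : Torus) : ℝ × ℝ :=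
  if Int.fract t < 1 / 2 then verticalShear α z else horizontalShear α z

/-- `φ` is the flow map of `u_α`: `φ₀ = id` and `d/dt φ_t(z) = u_α(t, φ_t(z))` for `t ≥ 0`.
The trajectory of `z` is differentiated through a continuous lift `c` to `ℝ²`. As `u_α` jumps in
time at the multiples of `1/2` and is continuous from the right there, the derivative is the right
derivative (which for a continuous curve is the same as the integrated equation). -/
def IsFlowMap (α : ℝ) (φ : ℝ → Torus → Torus) : Prop :=
  ∀ z : Torus, φ 0 z = z ∧ ∃ c : ℝ → ℝ × ℝ,
    ContinuousOn c (Ici 0) ∧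
    (∀ t : ℝ, 0 ≤ t → φ t z = proj (c t)) ∧
    (∀ t : ℝ, 0 ≤ t → HasDerivWithinAt c (velocity α t (φ t z)) (Ici t) t)

theorem tent_coe (x : ℝ) : tent (x : UnitAddCircle) = |Int.fract x - 1 / 2| := by
  unfold tent
  rw [show ((x : ℝ) : UnitAddCircle) = QuotientAddGroup.mk x from rfl,
    AddCircle.coe_equivIco_mk_apply]
  simp

/-- The explicit solution during one period, on the universal cover. -/
noncomputable def periodCurve (α s : ℝ) (p : ℝ × ℝ) : ℝ × ℝ :=
  (p.1 - 2 * α * max (s - 1 / 2) 0 * tent ((p.2 - α * tent p.1 : ℝ) : UnitAddCircle),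
    p.2 - 2 * α * min s (1 / 2) * tent (p.1 : UnitAddCircle))

theorem continuous_periodCurve (α : ℝ) (p : ℝ × ℝ) :
    Continuous fun s => periodCurve α s p := by
  unfold periodCurve; fun_prop

theorem periodCurve_zero (α : ℝ) (p : ℝ × ℝ) : periodCurve α 0 p = p := by
  simp [periodCurve]

theorem hasDerivWithinAt_periodCurve (α s : ℝ) (p : ℝ × ℝ) (hs : 0 ≤ s) (hs' : s < 1) :
    HasDerivWithinAt (fun s => periodCurve α s p) (velocity α s (proj (periodCurve α s p)))
      (Ici s) s := by
  have hf : Int.fract s = s := Int.fract_eq_self.2 ⟨hs, hs'⟩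
  by_cases h : s < 1 / 2
  · have h2 : HasDerivAt (fun t : ℝ => ((p.1, p.2 - 2 * α * t * tent (p.1 : UnitAddCircle)) :
        ℝ × ℝ)) ((0, -(2 * α * 1 * tent (p.1 : UnitAddCircle))) : ℝ × ℝ) s :=
      (hasDerivAt_const s p.1).prodMk
        ((((hasDerivAt_id s).const_mul (2 * α)).mul_const _).const_sub p.2)
    have e : velocity α s (proj (periodCurve α s p))
        = ((0, -(2 * α * 1 * tent (p.1 : UnitAddCircle))) : ℝ × ℝ) := by
      have : max (s - 1 / 2) 0 = 0 := max_eq_right (by linarith)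
      unfold velocity
      rw [hf, if_pos h]
      simp only [verticalShear, proj, periodCurve, this]
      ext <;> simp
    rw [e]
    refine (h2.congr_of_eventuallyEq ?_).hasDerivWithinAt
    filter_upwards [Iio_mem_nhds h] with t ht
    have ht : t < 1 / 2 := ht
    simp [periodCurve, max_eq_right (show t - 1 / 2 ≤ 0 by linarith), min_eq_left ht.le,
      -one_div]
  · push Not at h
    set q : UnitAddCircle := ((p.2 - α * tent p.1 : ℝ) : UnitAddCircle) with hq
    have h2 : HasDerivAt (fun t : ℝ => ((p.1 - 2 * α * (t - 1 / 2) * tent q,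
        p.2 - α * tent (p.1 : UnitAddCircle)) : ℝ × ℝ))
        ((-(2 * α * 1 * tent q), 0) : ℝ × ℝ) s :=
      (((((hasDerivAt_id s).sub_const (1 / 2)).const_mul (2 * α)).mul_const _).const_sub
        p.1).prodMk (hasDerivAt_const s _)
    have hy : ∀ t : ℝ, 1 / 2 ≤ t → periodCurve α t p = (p.1 - 2 * α * (t - 1 / 2) * tent q,
        p.2 - α * tent (p.1 : UnitAddCircle)) := by
      intro t ht
      unfold periodCurve
      rw [max_eq_left (by linarith), min_eq_right ht]
      ext
      · rfl
      · ring
    have e : velocity α s (proj (periodCurve α s p)) = ((-(2 * α * 1 * tent q), 0) : ℝ × ℝ) := by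
      unfold velocity
      rw [hf, if_neg (not_lt.2 h), hy s h]
      simp only [horizontalShear, proj, ← hq]
      ext <;> simp
    rw [e]
    exact h2.hasDerivWithinAt.congr (fun t ht => hy t (h.trans ht)) (hy s h)

/-- The flow map of `u_α` exists. -/
theorem exists_isFlowMap (α : ℝ) : ∃ φ : ℝ → Torus → Torus, IsFlowMap α φ := by
  have hsurj : ∀ z : Torus, ∃ p : ℝ × ℝ, proj p = z := by
    rintro ⟨x, y⟩
    obtain ⟨a, rfl⟩ := QuotientAddGroup.mk_surjective x
    obtain ⟨b, rfl⟩ := QuotientAddGroup.mk_surjective y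
    exact ⟨(a, b), rfl⟩
  choose r hr using hsurj
  let a : Torus → ℕ → ℝ × ℝ := fun z n => (periodCurve α 1)^[n] (r z)
  have ha : ∀ z n, a z (n + 1) = periodCurve α 1 (a z n) := fun z n =>
    Function.iterate_succ_apply' _ _ _
  let c : Torus → ℝ → ℝ × ℝ := fun z t => periodCurve α (t - ⌊t⌋₊) (a z ⌊t⌋₊)
  have hc : ∀ z (n : ℕ) (t : ℝ), (n : ℝ) ≤ t → t ≤ n + 1 →
      c z t = periodCurve α (t - n) (a z n) := by
    intro z n t h1 h2
    rcases h2.lt_or_eq with h2 | h2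
    · have : ⌊t⌋₊ = n := (Nat.floor_eq_iff (n.cast_nonneg.trans h1)).2 ⟨h1, h2⟩
      simp only [c, this]
    · have h3 : ⌊t⌋₊ = n + 1 := by
        rw [h2]; exact_mod_cast Nat.floor_natCast (R := ℝ) (n + 1)
      simp only [c, h3, ha]
      rw [h2]
      push_cast
      rw [sub_self, periodCurve_zero, add_sub_cancel_left]
  refine ⟨fun t z => proj (c z t), fun z => ⟨?_, c z, ?_, fun _ _ => rfl, ?_⟩⟩
  · have := hc z 0 0 (by simp) (by simp)
    simp only [this]
    simp [periodCurve_zero, a, hr]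
  · intro t ht
    have ht : (0 : ℝ) ≤ t := ht
    have hcl : ∀ n : ℕ, ContinuousOn (c z) (Icc (n : ℝ) (n + 1)) := fun n =>
      (((continuous_periodCurve α (a z n)).comp
        (continuous_id.sub continuous_const)).continuousOn).congr
        fun s hs => hc z n s hs.1 hs.2
    have hR : ContinuousWithinAt (c z) (Ici t) t := by
      have h1 := hcl ⌊t⌋₊ t ⟨Nat.floor_le ht, (Nat.lt_floor_add_one t).le⟩
      refine h1.mono_of_mem_nhdsWithin ?_
      filter_upwards [self_mem_nhdsWithin, mem_nhdsWithin_of_mem_nhds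
        (Iio_mem_nhds (Nat.lt_floor_add_one t))] with s hs hs'
      exact ⟨(Nat.floor_le ht).trans hs, le_of_lt hs'⟩
    rcases ht.eq_or_lt with rfl | ht0
    · exact hR
    · obtain ⟨n, hn⟩ : ∃ n : ℕ, ⌈t⌉₊ = n + 1 :=
        Nat.exists_eq_succ_of_ne_zero (Nat.ceil_pos.2 ht0).ne'
      have hn' := (Nat.ceil_eq_iff (Nat.succ_ne_zero n)).1 hn
      have hn1 : (n : ℝ) < t := by simpa using hn'.1
      have hn2 : t ≤ n + 1 := by exact_mod_cast hn'.2
      have hL : ContinuousWithinAt (c z) (Iic t) t := by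
        refine (hcl n t ⟨hn1.le, hn2⟩).mono_of_mem_nhdsWithin ?_
        filter_upwards [self_mem_nhdsWithin, mem_nhdsWithin_of_mem_nhds
          (Ioi_mem_nhds hn1)] with s hs hs'
        exact ⟨le_of_lt hs', le_trans hs hn2⟩
      exact (continuousAt_iff_continuous_left_right.2 ⟨hL, hR⟩).continuousWithinAt
  · intro t ht
    set n := ⌊t⌋₊ with hn
    have h1 : (n : ℝ) ≤ t := Nat.floor_le ht
    have h2 : t < n + 1 := Nat.lt_floor_add_one t
    have hv : velocity α t (proj (c z t)) =
        velocity α (t - n) (proj (periodCurve α (t - n) (a z n))) := by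
      rw [hc z n t h1 h2.le]
      unfold velocity
      rw [Int.fract_sub_natCast]
    have h3 := hasDerivWithinAt_periodCurve α (t - n) (a z n) (by linarith) (by linarith)
    have h4 : HasDerivWithinAt (fun s => periodCurve α (s - n) (a z n))
        (velocity α t (proj (c z t))) (Ici t) t := by
      rw [hv]
      have := h3.scomp t (((hasDerivAt_id t).sub_const (n : ℝ)).hasDerivWithinAt (s := Ici t))
        (fun s hs => sub_le_sub_right (show t ≤ s from hs) _)
      simpa [Function.comp_def] using this
    refine h4.congr_of_eventuallyEq ?_ (hc z n t h1 h2.le)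
    filter_upwards [self_mem_nhdsWithin, mem_nhdsWithin_of_mem_nhds (Iio_mem_nhds h2)]
      with s hs hs'
    exact hc z n s (h1.trans hs) (le_of_lt hs')

/-- The time-one map of any flow map of `u_α`; in particular it is unique. -/
theorem isFlowMap_one_eq {α : ℝ} {φ : ℝ → Torus → Torus} (h : IsFlowMap α φ) (z : Torus) :
    φ 1 z = (z.1 - ((α * tent (z.2 - ((α * tent z.1 : ℝ) : UnitAddCircle)) : ℝ) : UnitAddCircle),
      z.2 - ((α * tent z.1 : ℝ) : UnitAddCircle)) := by
  obtain ⟨h0, c, hc, hp, hd⟩ := h z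
  have hd1 : ∀ t, 0 ≤ t → HasDerivWithinAt (fun t => (c t).1) (velocity α t (φ t z)).1 (Ici t) t :=
    fun t ht => (ContinuousLinearMap.fst ℝ ℝ ℝ).hasFDerivAt.comp_hasDerivWithinAt t (hd t ht)
  have hd2 : ∀ t, 0 ≤ t → HasDerivWithinAt (fun t => (c t).2) (velocity α t (φ t z)).2 (Ici t) t :=
    fun t ht => (ContinuousLinearMap.snd ℝ ℝ ℝ).hasFDerivAt.comp_hasDerivWithinAt t (hd t ht)
  have hz : z = proj (c 0) := by rw [← hp 0 le_rfl, h0]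
  have hfr : ∀ t : ℝ, 0 ≤ t → t < 1 → Int.fract t = t := fun t a b => Int.fract_eq_self.2 ⟨a, b⟩
  have c1 : ContinuousOn (fun t => (c t).1) (Ici 0) := continuous_fst.comp_continuousOn hc
  have c2 : ContinuousOn (fun t => (c t).2) (Ici 0) := continuous_snd.comp_continuousOn hc
  have A : ∀ t ∈ Icc (0:ℝ) (1/2), (c t).1 = (c 0).1 :=
    constant_of_has_deriv_right_zero (c1.mono Icc_subset_Ici_self) fun t ht => by
      have := hd1 t ht.1
      rwa [velocity, hfr t ht.1 (by linarith [ht.2]), if_pos ht.2] at this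
  have B : ∀ t ∈ Icc (0:ℝ) (1/2), (c t).2 - t * (-2 * α * tent z.1) = (c 0).2 - 0 * (-2 * α * tent z.1) :=
    constant_of_has_deriv_right_zero ((c2.mono Icc_subset_Ici_self).sub (by fun_prop)) fun t ht => by
      have := (hd2 t ht.1).sub (((hasDerivAt_id t).mul_const (-2 * α * tent z.1)).hasDerivWithinAt)
      rw [velocity, hfr t ht.1 (by linarith [ht.2]), if_pos ht.2, hp t ht.1] at this
      have e : (proj (c t)).1 = z.1 := by rw [hz]; simp [proj, A t ⟨ht.1, ht.2.le⟩]
      refine HasDerivWithinAt.congr_deriv this ?_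
      simp [verticalShear, e]
  have C : ∀ t ∈ Icc (1/2:ℝ) 1, (c t).2 = (c (1/2)).2 :=
    constant_of_has_deriv_right_zero (c2.mono fun t ht => le_trans (by norm_num) ht.1) fun t ht => by
      have h0 : (0:ℝ) ≤ t := le_trans (by norm_num) ht.1
      have := hd2 t h0
      rwa [velocity, hfr t h0 (by linarith [ht.2]), if_neg (not_lt.2 ht.1)] at this
  set q := (proj (c (1/2))).2 with hq
  have D : ∀ t ∈ Icc (1/2:ℝ) 1, (c t).1 - t * (-2 * α * tent q) = (c (1/2)).1 - (1/2) * (-2 * α * tent q) :=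
    constant_of_has_deriv_right_zero ((c1.mono fun t ht => le_trans (by norm_num) ht.1).sub (by fun_prop)) fun t ht => by
      have h0 : (0:ℝ) ≤ t := le_trans (by norm_num) ht.1
      have := (hd1 t h0).sub (((hasDerivAt_id t).mul_const (-2 * α * tent q)).hasDerivWithinAt)
      rw [velocity, hfr t h0 (by linarith [ht.2]), if_neg (not_lt.2 ht.1), hp t h0] at this
      have e : (proj (c t)).2 = q := by rw [hq]; simp only [proj, C t ⟨ht.1, ht.2.le⟩]
      refine HasDerivWithinAt.congr_deriv this ?_
      simp [horizontalShear, e]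
  have a := A (1/2) (by norm_num)
  have b := B (1/2) (by norm_num)
  have c' := C 1 (by norm_num)
  have d := D 1 (by norm_num)
  have hq' : q = z.2 - ((α * tent z.1 : ℝ) : UnitAddCircle) := by
    rw [hq]
    have : (c (1/2)).2 = (c 0).2 - α * tent z.1 := by linarith
    have h2 : z.2 = ((c 0).2 : UnitAddCircle) := by rw [hz]; rfl
    simp only [proj, this]
    rw [h2, AddCircle.coe_sub]
  rw [← hq', hp 1 zero_le_one]
  have e1 : (c 1).1 = (c 0).1 - α * tent q := by linarith
  refine Prod.ext ?_ ?_
  · have h2 : z.1 = ((c 0).1 : UnitAddCircle) := by rw [hz]; rfl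
    simp only [proj, e1]
    rw [h2, AddCircle.coe_sub]
  · simp only [proj, c']; rw [hq]; rfl

/-- The flow map `φ_t` of `u_α` (for `t ≥ 0`; it is unique there). -/
noncomputable def flowMap (α : ℝ) : ℝ → Torus → Torus := (exists_isFlowMap α).choose

/-- The map `T = φ₁⁻¹`, the inverse of the time-one flow map of `u_α` (which is a bijection). -/
noncomputable def baseMap (α : ℝ) : Torus → Torus := Function.invFun (flowMap α 1)

/-- The vertical shear map `T₁(x, y) = (x, y + α |x - 1/2|) mod 1`. -/
noncomputable def shearOne (α : ℝ) (z : Torus) : Torus :=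
  (z.1, z.2 + ((α * tent z.1 : ℝ) : UnitAddCircle))

/-- The horizontal shear map `T₂(x, y) = (x + α |y - 1/2|, y) mod 1`. -/
noncomputable def shearTwo (α : ℝ) (z : Torus) : Torus :=
  (z.1 + ((α * tent z.2 : ℝ) : UnitAddCircle), z.2)

/-- `φ₁` is a bijection and its inverse is `T₁ ∘ T₂`. -/
theorem baseMap_eq (α : ℝ) : baseMap α = shearOne α ∘ shearTwo α := by
  have h := isFlowMap_one_eq (exists_isFlowMap α).choose_spec
  have inv : Function.LeftInverse (shearOne α ∘ shearTwo α) (flowMap α 1) := fun z => by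
    rw [flowMap, h]; simp [shearOne, shearTwo]
  have inv2 : Function.RightInverse (shearOne α ∘ shearTwo α) (flowMap α 1) := fun z => by
    rw [flowMap, h]; simp [shearOne, shearTwo]
  funext z
  apply inv.injective
  rw [inv2 z]
  exact Function.invFun_eq ⟨_, inv2 z⟩

/-- The kicked map `T_v(z) = T(z + π(v))`. -/
def kick (T : Torus → Torus) (v : ℝ × ℝ) (z : Torus) : Torus := T (z + proj v)

/-- The randomly kicked iterate `T_ξ^n = T_{ξ_n} ∘ ⋯ ∘ T_{ξ_1}`. The noise sequence
`(ξ_1, ξ_2, …)` is indexed from zero here, so that `ξ n` is its term number `n + 1`. -/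
def kickedIterate (T : Torus → Torus) (ξ : ℕ → ℝ × ℝ) : ℕ → Torus → Torus
  | 0 => id
  | n + 1 => kick T (ξ n) ∘ kickedIterate T ξ n

/-- The tiling `R_N` of the torus by the closed dyadic squares
`[j 2⁻ᴺ, (j+1) 2⁻ᴺ] × [k 2⁻ᴺ, (k+1) 2⁻ᴺ]`, `0 ≤ j, k ≤ 2ᴺ - 1`. -/
def dyadicSquares (N : ℕ) : Set (Set Torus) :=
  {R | ∃ j k : ℕ, j < 2 ^ N ∧ k < 2 ^ N ∧
    R = proj '' (Icc ((j : ℝ) / 2 ^ N) (((j : ℝ) + 1) / 2 ^ N) ×ˢ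
      Icc ((k : ℝ) / 2 ^ N) (((k : ℝ) + 1) / 2 ^ N))}

end KickedShear

/-!
Both choices of `T` are, up to the exchange of the two coordinates, the square of the half step
`halfShear α : (x, y) ↦ (y + α |x - 1/2|, x)`, so that the kicked iterates are compositions of half
steps with translations in between (`ShearChain`). On each of the two strips `[0, 1/2]` and
`[1/2, 1]` in `x` a half step is affine, and it stretches a segment of slope at most `1/16` by a
factor at least `|α| - 1/16 ≥ 16` into a segment of slope at most `1/16`. Expansion beats cutting: a
segment of width `ℓ` is cut into at most `2 ℓ + 2` pieces, so after `k` half steps the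
affine pieces of width at least `2` carry at least a quarter of its mass, up to an error `8⁻ᵏ`
(`ShearChain.le_setLIntegral`). For the horizontal segments foliating a square of side `2⁻ᴺ` this is
a definite fraction as soon as `k ≥ 2 N` (`ShearChain.le_setLIntegral_square`).

The inverse of a chain is, after exchanging the coordinates, a chain for `-α`
(`ShearChain.exists_inverse`), so the vertical segments foliating `Q` grow under the inverse as
well. Split the iterate as `F₂ ∘ F₁`. A nearly horizontal and a nearly vertical segment of width `2`
always cross transversally, and the pairs of their parameters giving points at distance at most `ε`
fill an area at least `ε²` (`sq_le_lintegral_nearDiagonal`). Integrating over both foliations, the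
pairs `(z, w) ∈ R × Q` with `dist (F₁ z) (F₂⁻¹ w) ≤ ε` have measure at least
`ε² (2⁻²ᴺ / 8)²`. On the other hand, `F₁` preserves the measure and balls of radius `ε` have measure
at most `4 ε²`, so this is at most `4 ε²` times the measure of the points of `Q` that `F₂⁻¹` maps
into the `ε`-neighbourhood of `F₁ R`. Dividing by `4 ε²` and letting `ε → 0` gives
`m(F₂ F₁ R ∩ Q) ≥ 2⁻⁴ᴺ / 256`.
-/

namespace KickedShear

open MeasureTheory Set
open scoped ENNReal

/-! ### Integrals over intervals and their pieces -/

lemma lintegral_comp_affine (H : ℝ → ℝ≥0∞) {d : ℝ} (hd : d ≠ 0) (q : ℝ) :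
    ∫⁻ x, H (d * x + q) = ENNReal.ofReal |d⁻¹| * ∫⁻ x, H x := by
  have h1 : ∫⁻ x, H (d * x + q) = ∫⁻ x, H (x + q) ∂(Measure.map (d * ·) volume) :=
    (lintegral_map_equiv (fun x => H (x + q))
      (Homeomorph.mulLeft₀ d hd).toMeasurableEquiv).symm
  rw [h1, Real.map_volume_mul_left hd, lintegral_smul_measure, lintegral_add_right_eq_self]
  rfl

/-- Stretching an interval by the factor `|d|` divides the additive error by `|d|`. -/
lemma le_setLIntegral_comp_affine {H : ℝ → ℝ≥0∞} {β : ℝ≥0∞} {A B d : ℝ} (hd : d ≠ 0) (q : ℝ)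
    (h : ∀ a b, a ≤ b → β * ENNReal.ofReal (A * (b - a) - B) ≤ ∫⁻ x in Ioc a b, H x)
    {a b : ℝ} (hab : a ≤ b) :
    β * ENNReal.ofReal (A * (b - a) - B / |d|) ≤ ∫⁻ x in Ioc a b, H (d * x + q) := by
  set lo := min (d * a + q) (d * b + q) with hlo
  set hi := max (d * a + q) (d * b + q) with hhi
  have hdpos : 0 < |d| := abs_pos.2 hd
  have hlen : hi - lo = |d| * (b - a) := by
    rw [hlo, hhi, max_sub_min_eq_abs, show d * b + q - (d * a + q) = d * (b - a) by ring,
      abs_mul, abs_of_nonneg (sub_nonneg.2 hab)]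
  have hind : ∀ x, (Icc a b).indicator (fun x => H (d * x + q)) x
      = (Icc lo hi).indicator H (d * x + q) := by
    intro x
    have : x ∈ Icc a b ↔ d * x + q ∈ Icc lo hi := by
      rw [hlo, hhi]
      rcases lt_or_gt_of_ne hd with hneg | hpos
      · rw [min_eq_right (by nlinarith), max_eq_left (by nlinarith)]
        constructor
        · rintro ⟨h1, h2⟩; constructor <;> nlinarith
        · rintro ⟨h1, h2⟩; constructor <;> nlinarith
      · rw [min_eq_left (by nlinarith), max_eq_right (by nlinarith)]
        constructor
        · rintro ⟨h1, h2⟩; constructor <;> nlinarith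
        · rintro ⟨h1, h2⟩; constructor <;> nlinarith
    by_cases hx : x ∈ Icc a b
    · rw [indicator_of_mem hx, indicator_of_mem (this.1 hx)]
    · rw [indicator_of_notMem hx, indicator_of_notMem (fun h => hx (this.2 h))]
  have key : ∫⁻ x in Ioc a b, H (d * x + q)
      = ENNReal.ofReal |d⁻¹| * ∫⁻ x in Ioc lo hi, H x := by
    rw [Measure.restrict_congr_set Ioc_ae_eq_Icc, Measure.restrict_congr_set Ioc_ae_eq_Icc,
      ← lintegral_indicator measurableSet_Icc, ← lintegral_indicator measurableSet_Icc,
      ← lintegral_comp_affine _ hd q]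
    exact lintegral_congr hind
  rw [key]
  refine le_trans (le_of_eq ?_) (mul_le_mul_right (h lo hi min_le_max) _)
  rw [hlen, mul_left_comm, ← ENNReal.ofReal_mul (abs_nonneg _), abs_inv]
  congr 2
  field_simp

lemma setLIntegral_Ioc_split (g : ℝ → ℝ≥0∞) {a b c : ℝ} (hac : a ≤ c) (hcb : c ≤ b) :
    ∫⁻ x in Ioc a b, g x = (∫⁻ x in Ioc a c, g x) + ∫⁻ x in Ioc c b, g x := by
  rw [← Ioc_union_Ioc_eq_Ioc hac hcb,
    lintegral_union measurableSet_Ioc (Ioc_disjoint_Ioc_of_le le_rfl)]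

/-- Gluing of lower bounds: an interval `(a, b]` meets at most `2 (b - a) + 2` of the cells
`[m/2, (m+1)/2]`, and the additive error `B` is lost once for each of them. -/
lemma le_setLIntegral_of_le_on_cells {g : ℝ → ℝ≥0∞} {β : ℝ≥0∞} {A B : ℝ} (hB : 0 ≤ B)
    (h : ∀ (m : ℤ) (a b : ℝ), (m : ℝ) / 2 ≤ a → a ≤ b → b ≤ ((m : ℝ) + 1) / 2 →
      β * ENNReal.ofReal (A * (b - a) - B) ≤ ∫⁻ x in Ioc a b, g x) {a b : ℝ} (hab : a ≤ b) :
    β * ENNReal.ofReal (A * (b - a) - B * (2 * (b - a) + 2)) ≤ ∫⁻ x in Ioc a b, g x := by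
  have aux : ∀ (n : ℕ) (a b : ℝ), a ≤ b → ⌈2 * b⌉ ≤ ⌊2 * a⌋ + n →
      β * ENNReal.ofReal (A * (b - a) - B * n) ≤ ∫⁻ x in Ioc a b, g x := by
    intro n
    induction n with
    | zero =>
      intro a b hab hn
      have h1 : (⌈2 * b⌉ : ℝ) ≤ ⌊2 * a⌋ := by exact_mod_cast (by simpa using hn)
      have : a = b := by linarith [Int.le_ceil (2 * b), Int.floor_le (2 * a)]
      simp [this]
    | succ n ih =>
      intro a b hab hn
      set m : ℤ := ⌊2 * a⌋ with hm
      have hfl := Int.floor_le (2 * a)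
      have hfl' := Int.lt_floor_add_one (2 * a)
      rw [← hm] at hfl hfl'
      have hb : 2 * b ≤ m + n + 1 := by
        refine (Int.le_ceil _).trans ?_
        exact_mod_cast (by push_cast at hn; linarith)
      set c : ℝ := (((m + n : ℤ) : ℝ)) / 2 with hc
      have hc2 : 2 * c = ((m + n : ℤ) : ℝ) := by rw [hc]; ring
      have hc3 : 2 * c = m + n := by rw [hc2]; push_cast; rfl
      have hBn : 0 ≤ B * n := by positivity
      rcases lt_or_ge c a with hca | hac
      · have hn0 : n = 0 := by
          by_contra h0
          have : (1 : ℝ) ≤ n := by exact_mod_cast Nat.one_le_iff_ne_zero.2 h0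
          linarith
        subst hn0
        have := h m a b (by linarith) hab (by simp at hb; linarith)
        simpa using this
      rcases lt_or_ge b c with hbc | hcb
      · refine le_trans ?_ (ih a b hab ?_)
        · gcongr
          linarith
        · rw [Int.ceil_le]; push_cast; linarith
      · rw [setLIntegral_Ioc_split g hac hcb]
        have h1 := ih a c hac (by rw [hc2, Int.ceil_intCast])
        have h2 := h (m + n) c b le_rfl hcb (by push_cast; linarith)
        refine le_trans ?_ (add_le_add h1 h2)
        rw [← mul_add]
        gcongr
        refine le_trans (le_of_eq ?_) ENNReal.ofReal_add_le
        congr 1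
        push_cast
        ring
  have hn : ⌊2 * a⌋ ≤ ⌈2 * b⌉ :=
    (Int.floor_le_floor (by linarith)).trans (Int.floor_le_ceil _)
  refine le_trans ?_ (aux (⌈2 * b⌉ - ⌊2 * a⌋).toNat a b hab ?_)
  · gcongr
    have : (((⌈2 * b⌉ - ⌊2 * a⌋).toNat : ℕ) : ℝ) = (⌈2 * b⌉ : ℝ) - ⌊2 * a⌋ := by
      exact_mod_cast Int.toNat_of_nonneg (by linarith)
    rw [this]
    linarith [Int.ceil_lt_add_one (2 * b), Int.lt_floor_add_one (2 * a)]
  · rw [Int.toNat_of_nonneg (by linarith)]; linarith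

lemma nat_mul_le_setLIntegral {g : ℝ → ℝ≥0∞} {β : ℝ≥0∞}
    (h : ∀ a, β ≤ ∫⁻ x in Ioc a (a + 2), g x) (n : ℕ) :
    ∀ a b : ℝ, a + 2 * n ≤ b → n * β ≤ ∫⁻ x in Ioc a b, g x := by
  induction n with
  | zero => simp
  | succ n ih =>
    intro a b hab
    push_cast at hab ⊢
    have hn : (0 : ℝ) ≤ n := n.cast_nonneg
    rw [setLIntegral_Ioc_split g (c := a + 2) (by linarith) (by linarith), add_mul, one_mul,
      add_comm]
    exact add_le_add (h a) (ih _ _ (by linarith))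

/-! ### Chains of half steps -/

/-- The shear `T₁` followed by the exchange of coordinates. Both `T₂ ∘ T₁` and, up to conjugation
by the exchange, `T₁ ∘ T₂` are its square. -/
noncomputable def halfShear (α : ℝ) (z : Torus) : Torus :=
  (z.2 + ((α * tent z.1 : ℝ) : UnitAddCircle), z.1)

/-- `ShearChain α k F`: the map `F` is a composition of `k` maps `halfShear α`, each preceded and
followed by an arbitrary translation. The constructor peels off the map applied first. -/
inductive ShearChain (α : ℝ) : ℕ → (Torus → Torus) → Prop
  | refl : ShearChain α 0 id
  | step {k : ℕ} {F : Torus → Torus} (v w : Torus) (hF : ShearChain α k F) :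
      ShearChain α (k + 1) (fun z => F (halfShear α (z + v) + w))

lemma exists_proj_eq (z : Torus) : ∃ p : ℝ × ℝ, proj p = z := by
  obtain ⟨x, y⟩ := z
  obtain ⟨a, rfl⟩ := QuotientAddGroup.mk_surjective x
  obtain ⟨b, rfl⟩ := QuotientAddGroup.mk_surjective y
  exact ⟨(a, b), rfl⟩

lemma proj_add (p q : ℝ × ℝ) : proj p + proj q = proj (p + q) := rfl

/-- On a cell `[m/2, (m+1)/2]` the tent function is affine of slope `±1`. -/
lemma exists_tent_eq_on_cell (m : ℤ) : ∃ e c : ℝ, |e| = 1 ∧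
    ∀ x : ℝ, (m : ℝ) / 2 ≤ x → x ≤ ((m : ℝ) + 1) / 2 → tent (x : UnitAddCircle) = e * x + c := by
  obtain ⟨j, rfl | rfl⟩ := Int.even_or_odd' m
  · refine ⟨-1, j + 1 / 2, by simp, fun x h1 h2 => ?_⟩
    push_cast at h1 h2
    have hf : ⌊x⌋ = j := Int.floor_eq_iff.2 ⟨by linarith, by linarith⟩
    rw [tent_coe, Int.fract, hf, abs_of_nonpos (by linarith)]; ring
  · refine ⟨1, -j - 1 / 2, by simp, fun x h1 h2 => ?_⟩
    push_cast at h1 h2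
    rcases lt_or_ge x (j + 1) with h3 | h3
    · have hf : ⌊x⌋ = j := Int.floor_eq_iff.2 ⟨by linarith, by linarith⟩
      rw [tent_coe, Int.fract, hf, abs_of_nonneg (by linarith)]; ring
    · have hx : x = ((j + 1 : ℤ) : ℝ) := by push_cast; linarith
      rw [tent_coe, hx, Int.fract_intCast]
      push_cast
      rw [zero_sub, abs_neg, abs_of_pos] <;> norm_num
      ring

/-- On a cell, the half shear maps a segment of slope `s` to a segment of slope `(s + α e)⁻¹`
with `e = ±1`, stretching it by the factor `s + α e`. -/
lemma exists_halfShear_proj_eq (α s y : ℝ) (w : ℝ × ℝ) (m : ℤ) : ∃ e q y' : ℝ, |e| = 1 ∧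
    (s + α * e ≠ 0 → ∀ x : ℝ, (m : ℝ) / 2 ≤ x → x ≤ ((m : ℝ) + 1) / 2 →
      halfShear α (proj (x, y + s * x)) + proj w =
        proj ((s + α * e) * x + q, y' + (s + α * e)⁻¹ * ((s + α * e) * x + q))) := by
  obtain ⟨e, c, he, h⟩ := exists_tent_eq_on_cell m
  refine ⟨e, y + α * c + w.1, w.2 - (s + α * e)⁻¹ * (y + α * c + w.1), he,
    fun hd x h1 h2 => ?_⟩
  have : halfShear α (proj (x, y + s * x)) = proj (y + s * x + α * (e * x + c), x) := by
    simp only [halfShear, proj, h x h1 h2, AddCircle.coe_add]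
  rw [this, proj_add]
  congr 1
  ext
  · simp; ring
  · simp only [Prod.snd_add]
    field_simp
    ring

/-- Growth of segments: if every segment of slope at most `1/16` and width `2` carries at least
the mass `β` of `Φ`, then a segment of width `ℓ` carries, after `k` half steps,
at least `β (ℓ/4 - 8⁻ᵏ)`. Each half step stretches by at least `16` and cuts a segment of width
`ℓ` into at most `2 ℓ + 2` affine pieces, so that the additive error shrinks by the factor `1/8`;
the multiplicative constant decreases from `1/2` and stays above `1/4`. -/
theorem ShearChain.le_setLIntegral {α : ℝ} (hα : 17 ≤ |α|) {k : ℕ} {F : Torus → Torus}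
    (hF : ShearChain α k F) {Φ : Torus → ℝ≥0∞} {β : ℝ≥0∞}
    (hΦ : ∀ s y a : ℝ, |s| ≤ 1 / 16 → β ≤ ∫⁻ x in Ioc a (a + 2), Φ (proj (x, y + s * x)))
    (s y : ℝ) (hs : |s| ≤ 1 / 16) {a b : ℝ} (hab : a ≤ b) :
    β * ENNReal.ofReal ((1 / 4 + 1 / 4 * (1 / 8) ^ k) * (b - a) - (1 / 8) ^ k) ≤
      ∫⁻ x in Ioc a b, Φ (F (proj (x, y + s * x))) := by
  induction hF generalizing s y a b with
  | refl =>
    refine le_trans ?_ (nat_mul_le_setLIntegral (fun a => hΦ s y a hs) ⌊(b - a) / 2⌋₊ a b ?_)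
    · rw [mul_comm]
      gcongr
      rw [← ENNReal.ofReal_natCast]
      refine ENNReal.ofReal_le_ofReal ?_
      have := (Nat.lt_floor_add_one ((b - a) / 2)).le
      norm_num
      linarith
    · have := Nat.floor_le (show 0 ≤ (b - a) / 2 by linarith)
      linarith
  | @step k F v w hF ih =>
    obtain ⟨v, rfl⟩ := exists_proj_eq v
    obtain ⟨w, rfl⟩ := exists_proj_eq w
    set y₁ : ℝ := y + v.2 - s * v.1 with hy₁
    have hshift : ∫⁻ x in Ioc a b, Φ (F (halfShear α (proj (x, y + s * x) + proj v) + proj w))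
        = ∫⁻ x in Ioc (a + v.1) (b + v.1),
            Φ (F (halfShear α (proj (x, y₁ + s * x)) + proj w)) := by
      rw [← lintegral_indicator measurableSet_Ioc, ← lintegral_indicator measurableSet_Ioc]
      refine Eq.trans ?_ (lintegral_add_right_eq_self _ v.1)
      refine lintegral_congr fun x => ?_
      have e : proj (x, y + s * x) + proj v = proj (x + v.1, y₁ + s * (x + v.1)) := by
        rw [proj_add]; congr 1; ext
        · rfl
        · simp [hy₁]; ring
      simp only [indicator, mem_Ioc, add_lt_add_iff_right, add_le_add_iff_right, e]
    rw [hshift]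
    have hpos : (0 : ℝ) < (1 / 8) ^ k := by positivity
    -- On each cell the segment is stretched by at least `16`, whence the error `8⁻ᵏ / 16`.
    have hcell := le_setLIntegral_of_le_on_cells (β := β)
      (g := fun x => Φ (F (halfShear α (proj (x, y₁ + s * x)) + proj w)))
      (A := 1 / 4 + 1 / 4 * (1 / 8) ^ k) (B := (1 / 8) ^ k / 16) (by positivity) (by
        intro m a b hma hab hbm
        obtain ⟨e, q, y', he, h⟩ := exists_halfShear_proj_eq α s y₁ w m
        have hd : 16 ≤ |s + α * e| := by
          have h1 : |α * e| = |α| := by rw [abs_mul, he, mul_one]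
          have h2 := abs_sub_abs_le_abs_add (α * e) s
          rw [add_comm s]
          linarith
        have hd0 : s + α * e ≠ 0 := by
          intro h0; rw [h0] at hd; norm_num at hd
        have hs' : |(s + α * e)⁻¹| ≤ 1 / 16 := by
          rw [abs_inv, one_div]; exact inv_anti₀ (by norm_num) hd
        have := le_setLIntegral_comp_affine hd0 q
          (H := fun X => Φ (F (proj (X, y' + (s + α * e)⁻¹ * X))))
          (fun a b hab => ih (s + α * e)⁻¹ y' hs' hab) hab
        refine le_trans ?_ (this.trans (le_of_eq ?_))
        · gcongr
        · refine setLIntegral_congr_fun measurableSet_Ioc fun x hx => ?_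
          rw [h hd0 x (hma.trans hx.1.le) (hx.2.trans hbm)])
      (a := a + v.1) (b := b + v.1) (by linarith)
    refine le_trans ?_ hcell
    refine mul_le_mul_right (ENNReal.ofReal_le_ofReal ?_) _
    rw [pow_succ]
    nlinarith

/-! ### Structure of chains -/

lemma tent_eq_half_sub_norm (x : UnitAddCircle) : tent x = 1 / 2 - ‖x‖ := by
  obtain ⟨x, rfl⟩ := QuotientAddGroup.mk_surjective x
  have h1 : tent (x : UnitAddCircle) = |Int.fract x - 1 / 2| := tent_coe x
  have h2 : ‖(x : UnitAddCircle)‖ = |x - round x| := UnitAddCircle.norm_eq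
  refine h1.trans (Eq.trans ?_ (congrArg (1 / 2 - ·) h2.symm))
  simp only [abs_sub_round_eq_min]
  rcases le_total (Int.fract x) (1 / 2) with h | h
  · rw [abs_of_nonpos (by linarith), min_eq_left (by linarith)]; ring
  · rw [abs_of_nonneg (by linarith), min_eq_right (by linarith)]; ring

lemma continuous_tent : Continuous tent := by
  simp only [funext tent_eq_half_sub_norm]; fun_prop

lemma continuous_halfShear (α : ℝ) : Continuous (halfShear α) := by
  have h1 : Continuous fun z : Torus => α * tent z.1 :=
    continuous_const.mul (continuous_tent.comp continuous_fst)
  have h2 : Continuous fun z : Torus => ((α * tent z.1 : ℝ) : UnitAddCircle) :=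
    (AddCircle.continuous_mk' 1).comp h1
  exact (continuous_snd.add h2).prodMk continuous_fst

lemma continuous_proj : Continuous proj :=
  ((AddCircle.continuous_mk' 1).comp continuous_fst).prodMk
    ((AddCircle.continuous_mk' 1).comp continuous_snd)

lemma measurePreserving_swap_torus : MeasurePreserving (Prod.swap : Torus → Torus) :=
  Measure.measurePreserving_swap

lemma measurePreserving_halfShear (α : ℝ) : MeasurePreserving (halfShear α) := by
  have h : MeasurePreserving
      (fun z : Torus => (z.1, z.2 + ((α * tent z.1 : ℝ) : UnitAddCircle))) := by
    refine MeasurePreserving.skew_product (MeasurePreserving.id volume)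
      (g := fun x y => y + ((α * tent x : ℝ) : UnitAddCircle)) ?_ ?_
    · exact (continuous_snd.comp (continuous_halfShear α |>.comp continuous_id |>.prodMk
        (continuous_fst.comp (continuous_halfShear α)))).measurable
    · exact Filter.Eventually.of_forall fun x => (measurePreserving_add_right volume _).map_eq
  exact measurePreserving_swap_torus.comp h

lemma ShearChain.continuous {α : ℝ} {k : ℕ} {F : Torus → Torus} (hF : ShearChain α k F) :
    Continuous F := by
  induction hF with
  | refl => exact continuous_id
  | step v w _ ih =>
    exact ih.comp (((continuous_halfShear α).comp (by fun_prop)).add continuous_const)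

lemma measurePreserving_add_torus (v : Torus) : MeasurePreserving (fun z : Torus => z + v) :=
  (measurePreserving_add_right volume v.1).prod (measurePreserving_add_right volume v.2)

lemma ShearChain.measurePreserving {α : ℝ} {k : ℕ} {F : Torus → Torus} (hF : ShearChain α k F) :
    MeasurePreserving F := by
  induction hF with
  | refl => exact MeasurePreserving.id _
  | step v w _ ih =>
    exact ih.comp ((measurePreserving_add_torus w).comp
      ((measurePreserving_halfShear α).comp (measurePreserving_add_torus v)))

lemma ShearChain.append {α : ℝ} {k : ℕ} {F : Torus → Torus} (hF : ShearChain α k F)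
    (v w : Torus) : ShearChain α (k + 1) (fun z => halfShear α (F z + v) + w) := by
  induction hF with
  | refl => exact .step v w .refl
  | step v' w' _ ih => exact .step v' w' ih

lemma ShearChain.exists_comp {α : ℝ} {n : ℕ} {F : Torus → Torus} (hF : ShearChain α n F) :
    ∀ k l : ℕ, n = k + l → ∃ F₁ F₂, ShearChain α k F₁ ∧ ShearChain α l F₂ ∧ F = F₂ ∘ F₁ := by
  induction hF with
  | refl =>
    intro k l h
    obtain ⟨rfl, rfl⟩ : k = 0 ∧ l = 0 := by omega
    exact ⟨id, id, .refl, .refl, rfl⟩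
  | @step n F v w hF ih =>
    intro k l h
    cases k with
    | zero =>
      obtain rfl : l = n + 1 := by omega
      exact ⟨id, _, .refl, .step v w hF, rfl⟩
    | succ k =>
      obtain ⟨F₁, F₂, h1, h2, rfl⟩ := ih k l (by omega)
      exact ⟨_, F₂, .step v w h1, h2, rfl⟩

lemma swap_add (z w : Torus) : (z + w).swap = z.swap + w.swap := rfl

lemma halfShear_swap_halfShear_neg (α : ℝ) (z : Torus) :
    halfShear α (halfShear (-α) z).swap = z.swap := by
  ext <;> simp [halfShear]

/-- Conjugation by the exchange of coordinates turns the inverse of a chain into a chain for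
`-α`; hence the stable segments grow under the inverse just as the unstable ones do. -/
lemma ShearChain.exists_inverse {α : ℝ} {k : ℕ} {F : Torus → Torus} (hF : ShearChain α k F) :
    ∃ G, ShearChain (-α) k G ∧ ∀ z, F (G z).swap = z.swap := by
  induction hF with
  | refl => exact ⟨id, .refl, fun _ => rfl⟩
  | @step k F v w hF ih =>
    obtain ⟨G, hG, h⟩ := ih
    refine ⟨_, hG.append (-w.swap) (-v.swap), fun z => ?_⟩
    rw [← h z]
    change F (halfShear α ((halfShear (-α) (G z + -w.swap) + -v.swap).swap + v) + w) = _
    congr 1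
    rw [swap_add, show (-v.swap).swap = -v from rfl, neg_add_cancel_right,
      halfShear_swap_halfShear_neg, swap_add, show (-w.swap).swap = -w from rfl,
      neg_add_cancel_right]

/-! ### Dyadic squares -/

lemma measurePreserving_proj :
    MeasurePreserving proj ((volume : Measure (ℝ × ℝ)).restrict (Ioc 0 1 ×ˢ Ioc 0 1)) := by
  have h := (UnitAddCircle.measurePreserving_mk 0).prod (UnitAddCircle.measurePreserving_mk 0)
  rw [Measure.prod_restrict, zero_add] at h
  exact h

lemma setLIntegral_prod_le_setLIntegral_proj_image {f : Torus → ℝ≥0∞} (hf : Measurable f)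
    {a b c d : ℝ} (ha : 0 ≤ a) (hb : b ≤ 1) (hc : 0 ≤ c) (hd : d ≤ 1) :
    ∫⁻ p in Ioc a b ×ˢ Ioc c d, f (proj p) ≤ ∫⁻ z in proj '' (Icc a b ×ˢ Icc c d), f z := by
  have hm : MeasurableSet (proj '' (Icc a b ×ˢ Icc c d)) :=
    ((isCompact_Icc.prod isCompact_Icc).image continuous_proj).isClosed.measurableSet
  rw [← lintegral_indicator hm, ← measurePreserving_proj.lintegral_comp (hf.indicator hm)]
  refine le_trans ?_ (lintegral_mono_set
    (prod_mono (Ioc_subset_Ioc ha hb) (Ioc_subset_Ioc hc hd)))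
  refine setLIntegral_mono' (measurableSet_Ioc.prod measurableSet_Ioc) fun p hp => ?_
  rw [indicator_of_mem]
  exact ⟨p, prod_mono Ioc_subset_Icc_self Ioc_subset_Icc_self hp, rfl⟩

lemma isClosed_of_mem_dyadicSquares {N : ℕ} {R : Set Torus} (hR : R ∈ dyadicSquares N) :
    IsClosed R := by
  obtain ⟨j, k, -, -, rfl⟩ := hR
  exact ((isCompact_Icc.prod isCompact_Icc).image continuous_proj).isClosed

lemma swap_image_mem_dyadicSquares {N : ℕ} {R : Set Torus} (hR : R ∈ dyadicSquares N) :
    Prod.swap '' R ∈ dyadicSquares N := by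
  obtain ⟨j, k, hj, hk, rfl⟩ := hR
  refine ⟨k, j, hk, hj, ?_⟩
  rw [← image_swap_prod, image_image, image_image]
  rfl

lemma eq_univ_of_mem_dyadicSquares_zero {R : Set Torus} (hR : R ∈ dyadicSquares 0) :
    R = univ := by
  obtain ⟨j, k, hj, hk, rfl⟩ := hR
  obtain ⟨rfl, rfl⟩ : j = 0 ∧ k = 0 := by simpa using And.intro hj hk
  refine eq_univ_of_forall fun z => ?_
  obtain ⟨p, rfl⟩ := exists_proj_eq z
  refine ⟨(Int.fract p.1, Int.fract p.2), ?_, ?_⟩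
  · simp [(Int.fract_lt_one _).le]
  · have h : ∀ x : ℝ, ((Int.fract x : ℝ) : UnitAddCircle) = x := fun x => by
      conv_rhs => rw [← Int.fract_add_floor x]
      rw [AddCircle.coe_add]
      have : ((⌊x⌋ : ℝ) : UnitAddCircle) = 0 := by
        rw [AddCircle.coe_eq_zero_iff]; exact ⟨⌊x⌋, by simp⟩
      rw [this, add_zero]
    simp only [proj, h]

lemma norm_coe_le_abs (x : ℝ) : ‖(x : UnitAddCircle)‖ ≤ |x| := by
  rw [UnitAddCircle.norm_eq]
  simpa using round_le x 0

lemma volume_closedBall_le (z : Torus) {ε : ℝ} (hε : 0 ≤ ε) :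
    volume (Metric.closedBall z ε) ≤ ENNReal.ofReal (4 * ε ^ 2) := by
  have h : ∀ x : UnitAddCircle, volume (Metric.closedBall x ε) ≤ ENNReal.ofReal (2 * ε) :=
    fun x => by
      rw [AddCircle.volume_closedBall]; exact ENNReal.ofReal_le_ofReal (min_le_right _ _)
  rw [← closedBall_prod_same, Measure.volume_eq_prod, Measure.prod_prod]
  refine (mul_le_mul' (h _) (h _)).trans (le_of_eq ?_)
  rw [← ENNReal.ofReal_mul (by positivity)]
  congr 1; ring

lemma volumeReal_le_of_mem_dyadicSquares {N : ℕ} {R : Set Torus} (hR : R ∈ dyadicSquares N) :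
    volume.real R ≤ ((1 / 2) ^ N) ^ 2 := by
  obtain ⟨j, k, -, -, rfl⟩ := hR
  set ℓ : ℝ := (1 / 2) ^ N with hℓ
  have hℓ0 : 0 < ℓ := by positivity
  have hdiv : ∀ x : ℝ, x / 2 ^ N = x * ℓ := fun x => by rw [hℓ, one_div, inv_pow]; rfl
  have hsub : proj '' (Icc ((j : ℝ) / 2 ^ N) (((j : ℝ) + 1) / 2 ^ N) ×ˢ
      Icc ((k : ℝ) / 2 ^ N) (((k : ℝ) + 1) / 2 ^ N)) ⊆
      Metric.closedBall (proj ((j + 1 / 2) * ℓ, (k + 1 / 2) * ℓ)) (ℓ / 2) := by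
    simp only [hdiv]
    rintro _ ⟨⟨x, y⟩, ⟨⟨h1, h2⟩, ⟨h3, h4⟩⟩, rfl⟩
    simp only at h1 h2 h3 h4
    rw [Metric.mem_closedBall, Prod.dist_eq, max_le_iff]
    simp only [proj, dist_eq_norm, ← AddCircle.coe_sub]
    exact ⟨(norm_coe_le_abs _).trans (abs_le.2 ⟨by linarith, by linarith⟩),
      (norm_coe_le_abs _).trans (abs_le.2 ⟨by linarith, by linarith⟩)⟩
  refine ENNReal.toReal_le_of_le_ofReal (by positivity) ((measure_mono hsub).trans ?_)
  refine (volume_closedBall_le _ (by positivity)).trans (le_of_eq ?_)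
  congr 1; ring

/-- Growth of squares: the segments foliating a dyadic square of side `2⁻ᴺ` all become long
after `2 N` half steps. -/
lemma ShearChain.le_setLIntegral_square {α : ℝ} (hα : 17 ≤ |α|) {k N : ℕ} (hN : 1 ≤ N)
    (hk : 2 * N ≤ k) {F : Torus → Torus} (hF : ShearChain α k F) {Φ : Torus → ℝ≥0∞}
    (hm : Measurable Φ) {β : ℝ≥0∞}
    (hΦ : ∀ s y a : ℝ, |s| ≤ 1 / 16 → β ≤ ∫⁻ x in Ioc a (a + 2), Φ (proj (x, y + s * x)))
    {R : Set Torus} (hR : R ∈ dyadicSquares N) :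
    β * ENNReal.ofReal (((1 / 2) ^ N) ^ 2 / 8) ≤ ∫⁻ z in R, Φ (F z) := by
  obtain ⟨i, j, hi, hj, rfl⟩ := hR
  set ℓ : ℝ := (1 / 2) ^ N with hℓ
  have hℓ0 : 0 < ℓ := by positivity
  have hdiv : ∀ x : ℝ, x / 2 ^ N = x * ℓ := fun x => by rw [hℓ, one_div, inv_pow]; rfl
  have hle : ∀ i : ℕ, i < 2 ^ N → ((i : ℝ) + 1) / 2 ^ N ≤ 1 := fun i hi => by
    rw [div_le_one (by positivity)]; exact_mod_cast hi
  have hΦF : Measurable fun z => Φ (F z) := hm.comp hF.continuous.measurable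
  refine le_trans ?_ (setLIntegral_prod_le_setLIntegral_proj_image hΦF
    (by positivity) (hle i hi) (by positivity) (hle j hj))
  rw [Measure.volume_eq_prod,
    setLIntegral_prod_symm (fun p => Φ (F (proj p)))
      (hΦF.comp continuous_proj.measurable).aemeasurable]
  have hpow : (1 / 8 : ℝ) ^ k ≤ ℓ / 8 := by
    calc (1 / 8 : ℝ) ^ k ≤ (1 / 8) ^ (2 * N) :=
          pow_le_pow_of_le_one (by norm_num) (by norm_num) hk
      _ = ℓ * (1 / 32) ^ N := by rw [hℓ, pow_mul, ← mul_pow]; norm_num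
      _ ≤ ℓ * (1 / 32) ^ 1 :=
          mul_le_mul_of_nonneg_left (pow_le_pow_of_le_one (by norm_num) (by norm_num) hN) hℓ0.le
      _ ≤ ℓ / 8 := by linarith
  have hseg : ∀ t : ℝ, β * ENNReal.ofReal (ℓ / 8) ≤
      ∫⁻ x in Ioc ((i : ℝ) / 2 ^ N) (((i : ℝ) + 1) / 2 ^ N), Φ (F (proj (x, t))) := fun t => by
    have h := hF.le_setLIntegral hα hΦ 0 t (by norm_num)
      (a := (i : ℝ) / 2 ^ N) (b := ((i : ℝ) + 1) / 2 ^ N) (by gcongr; linarith)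
    simp only [zero_mul, add_zero] at h
    refine le_trans (mul_le_mul_right (ENNReal.ofReal_le_ofReal ?_) _) h
    rw [hdiv, hdiv]
    have : (0 : ℝ) ≤ (1 / 8) ^ k * ℓ := by positivity
    nlinarith
  refine le_trans (le_of_eq ?_) (lintegral_mono hseg)
  rw [setLIntegral_const, Real.volume_Ioc, mul_assoc, ← ENNReal.ofReal_mul (by positivity),
    hdiv, hdiv]
  congr 2; ring

/-! ### Crossings of unstable and stable segments -/

/-- The pairs of points of the torus at distance at most `ε`. -/
def nearDiagonal (ε : ℝ) : Set (Torus × Torus) := {p | dist p.1 p.2 ≤ ε}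

lemma measurableSet_nearDiagonal (ε : ℝ) : MeasurableSet (nearDiagonal ε) :=
  (isClosed_le continuous_dist continuous_const).measurableSet

lemma exists_int_add_mem (c x : ℝ) : ∃ m : ℤ, |x + m - c| ≤ 1 / 2 := by
  refine ⟨-round (x - c), ?_⟩
  have := abs_sub_round (x - c)
  push_cast
  rwa [show x + -(round (x - c) : ℝ) - c = x - c - round (x - c) by ring]

lemma norm_coe_le_of_add_int (x : ℝ) (m : ℤ) : ‖(x : UnitAddCircle)‖ ≤ |x + m| := by
  rw [UnitAddCircle.norm_eq]
  simpa using round_le x (-m)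

/-- A nearly horizontal and a nearly vertical segment of width two cross transversally at a point
which is not close to the end points. -/
lemma sq_le_lintegral_nearDiagonal {ε : ℝ} (hε : 0 < ε) (hε' : ε ≤ 1 / 2) {s s' : ℝ}
    (hs : |s| ≤ 1 / 16) (hs' : |s'| ≤ 1 / 16) (y x' a a' : ℝ) :
    ENNReal.ofReal (ε ^ 2) ≤ ∫⁻ x in Ioc a (a + 2), ∫⁻ u in Ioc a' (a' + 2),
      (nearDiagonal ε).indicator 1 (proj (x, y + s * x), (proj (u, x' + s' * u)).swap) := by
  obtain ⟨m, hm⟩ := exists_int_add_mem (a + 1) (x' + s' * (a' + 1))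
  obtain ⟨l, hl⟩ := exists_int_add_mem (a' + 1) (y + s * (a + 1))
  -- `(X, U)` are the parameters of the crossing point: `X = x' + s' U + m`, `U = y + s X + l`.
  have hss : |s * s'| ≤ 1 / 256 := by
    rw [abs_mul]
    calc |s| * |s'| ≤ 1 / 16 * (1 / 16) := by gcongr
      _ = 1 / 256 := by norm_num
  have hdet : (1 - s * s') ≠ 0 := by have := (abs_le.1 hss).2; intro h; linarith
  obtain ⟨X, hX⟩ : ∃ X : ℝ, X = x' + m + s' * (y + l + s * X) :=
    ⟨(x' + m + s' * (y + l)) / (1 - s * s'), by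
      linear_combination div_mul_cancel₀ (x' + m + s' * (y + l)) hdet⟩
  set U : ℝ := y + l + s * X with hU
  have h1 : |X - (a + 1)| ≤ 1 / 2 + 1 / 16 * |U - (a' + 1)| := by
    calc |X - (a + 1)| = |(x' + s' * (a' + 1) + m - (a + 1)) + s' * (U - (a' + 1))| := by
          congr 1; linarith
      _ ≤ 1 / 2 + 1 / 16 * |U - (a' + 1)| := by
          refine (abs_add_le _ _).trans (add_le_add hm ?_)
          rw [abs_mul]; gcongr
  have h2 : |U - (a' + 1)| ≤ 1 / 2 + 1 / 16 * |X - (a + 1)| := by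
    calc |U - (a' + 1)| = |(y + s * (a + 1) + l - (a' + 1)) + s * (X - (a + 1))| := by
          congr 1; rw [hU]; ring
      _ ≤ 1 / 2 + 1 / 16 * |X - (a + 1)| := by
          refine (abs_add_le _ _).trans (add_le_add hl ?_)
          rw [abs_mul]; gcongr
  have h3 := abs_le.1 (show |X - (a + 1)| ≤ 3 / 4 by linarith)
  have h4 := abs_le.1 (show |U - (a' + 1)| ≤ 3 / 4 by linarith)
  have hin : ∀ x ∈ Ioc (X - ε / 2) (X + ε / 2), ENNReal.ofReal ε ≤ ∫⁻ u in Ioc a' (a' + 2),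
      (nearDiagonal ε).indicator 1 (proj (x, y + s * x), (proj (u, x' + s' * u)).swap) := by
    intro x hx
    refine le_trans ?_ (lintegral_mono_set
      (Ioc_subset_Ioc (show a' ≤ U - ε / 2 by linarith)
        (show U + ε / 2 ≤ a' + 2 by linarith)))
    have hone : ∀ u ∈ Ioc (U - ε / 2) (U + ε / 2), (1 : ℝ≥0∞) ≤
        (nearDiagonal ε).indicator 1 (proj (x, y + s * x), (proj (u, x' + s' * u)).swap) := by
      intro u hu
      have hx1 : |x - X| ≤ ε / 2 := abs_le.2 ⟨by linarith [hx.1], by linarith [hx.2]⟩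
      have hu1 : |u - U| ≤ ε / 2 := abs_le.2 ⟨by linarith [hu.1], by linarith [hu.2]⟩
      have hb : ∀ {t r p : ℝ}, |t| ≤ 1 / 16 → |r| ≤ ε / 2 → |p| ≤ ε / 2 → |r + t * p| ≤ ε := by
        intro t r p ht hr hp
        refine (abs_add_le _ _).trans ?_
        have : |t * p| ≤ 1 / 16 * (ε / 2) := by rw [abs_mul]; gcongr
        linarith
      rw [indicator_of_mem]
      · rfl
      rw [nearDiagonal, mem_ofPred_eq, Prod.dist_eq, max_le_iff]
      simp only [proj, Prod.swap, dist_eq_norm, ← AddCircle.coe_sub]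
      refine ⟨(norm_coe_le_of_add_int _ (-m)).trans ?_, (norm_coe_le_of_add_int _ l).trans ?_⟩
      · rw [show x - (x' + s' * u) + ((-m : ℤ) : ℝ) = (x - X) + (-s') * (u - U) by
          push_cast; linarith]
        exact hb (by rwa [abs_neg]) hx1 hu1
      · rw [show y + s * x - u + (l : ℝ) = -(u - U) + s * (x - X) by rw [hU]; ring]
        exact hb hs (by rwa [abs_neg]) hx1
    refine le_trans (le_of_eq ?_) (setLIntegral_mono' measurableSet_Ioc hone)
    rw [setLIntegral_const, Real.volume_Ioc, one_mul]
    congr 1; ring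
  refine le_trans ?_ (lintegral_mono_set
    (Ioc_subset_Ioc (show a ≤ X - ε / 2 by linarith)
      (show X + ε / 2 ≤ a + 2 by linarith)))
  refine le_trans (le_of_eq ?_) (setLIntegral_mono' measurableSet_Ioc hin)
  rw [setLIntegral_const, Real.volume_Ioc, ← ENNReal.ofReal_mul hε.le]
  congr 1; ring

/-! ### Mixing -/

/-- Many pairs of points `z ∈ R`, `w ∈ Q` have `F z` close to `G w` with its coordinates exchanged:
the segments of `F '' R` become long and nearly horizontal, the exchanged ones of `G '' Q` long and
nearly vertical, and any two of these cross. -/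
lemma le_setLIntegral_nearDiagonal {α : ℝ} (hα : 17 ≤ |α|) {k l N : ℕ} (hN : 1 ≤ N)
    (hk : 2 * N ≤ k) (hl : 2 * N ≤ l) {F G : Torus → Torus} (hF : ShearChain α k F)
    (hG : ShearChain (-α) l G) {R Q : Set Torus} (hR : R ∈ dyadicSquares N)
    (hQ : Q ∈ dyadicSquares N) {ε : ℝ} (hε : 0 < ε) (hε' : ε ≤ 1 / 2) :
    ENNReal.ofReal (ε ^ 2) * ENNReal.ofReal (((1 / 2) ^ N) ^ 2 / 8) *
        ENNReal.ofReal (((1 / 2) ^ N) ^ 2 / 8) ≤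
      ∫⁻ w in Q, ∫⁻ z in R, (nearDiagonal ε).indicator 1 (F z, (G w).swap) := by
  have hI : Measurable ((nearDiagonal ε).indicator (1 : Torus × Torus → ℝ≥0∞)) :=
    measurable_one.indicator (measurableSet_nearDiagonal ε)
  have hFm := hF.continuous.measurable
  have hpm := continuous_proj.measurable
  refine hG.le_setLIntegral_square (by rwa [abs_neg]) hN hl
    (Φ := fun w => ∫⁻ z in R, (nearDiagonal ε).indicator 1 (F z, w.swap)) ?_ ?_ hQ
  · exact Measurable.lintegral_prod_right'
      (f := fun p : Torus × Torus => (nearDiagonal ε).indicator 1 (F p.2, p.1.swap))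
      (hI.comp (by fun_prop))
  · intro s' x' a' hs'
    have hline : Measurable fun u : ℝ => (proj (u, x' + s' * u)).swap :=
      measurable_swap.comp (hpm.comp (by fun_prop : Measurable fun u : ℝ => (u, x' + s' * u)))
    rw [lintegral_lintegral_swap]
    · refine hF.le_setLIntegral_square hα hN hk
        (Φ := fun z => ∫⁻ u in Ioc a' (a' + 2),
          (nearDiagonal ε).indicator 1 (z, (proj (u, x' + s' * u)).swap)) ?_ ?_ hR
      · exact Measurable.lintegral_prod_right'
          (f := fun p : Torus × ℝ =>
            (nearDiagonal ε).indicator 1 (p.1, (proj (p.2, x' + s' * p.2)).swap))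
          (hI.comp (measurable_fst.prodMk (hline.comp measurable_snd)))
      · exact fun s y a hs => sq_le_lintegral_nearDiagonal hε hε' hs hs' y x' a a'
    · exact (hI.comp ((hFm.comp measurable_snd).prodMk
        (hline.comp measurable_fst))).aemeasurable

/-- Mixing for a composition of two long chains: the first one makes the unstable segments of `R`
long, the inverse of the second one makes the stable segments of `Q` long. -/
theorem ShearChain.le_volumeReal_image_inter {α : ℝ} (hα : 17 ≤ |α|) {k l N : ℕ} (hN : 1 ≤ N)
    (hk : 2 * N ≤ k) (hl : 2 * N ≤ l) {F₁ F₂ : Torus → Torus} (hF₁ : ShearChain α k F₁)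
    (hF₂ : ShearChain α l F₂) {R Q : Set Torus} (hR : R ∈ dyadicSquares N)
    (hQ : Q ∈ dyadicSquares N) :
    ((1 / 2) ^ N) ^ 4 / 256 ≤ volume.real ((F₂ ∘ F₁) '' R ∩ Q) := by
  obtain ⟨G, hG, hinv⟩ := hF₂.exists_inverse
  set ℓ : ℝ := (1 / 2) ^ N with hℓ
  set Q' : Set Torus := Prod.swap '' Q with hQ'
  have hQ'mem : Q' ∈ dyadicSquares N := swap_image_mem_dyadicSquares hQ
  -- `E` is the inverse of `F₂` precomposed with the exchange of coordinates.
  set E : Torus → Torus := fun w => (G w).swap with hE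
  have hEm : Measurable E := measurable_swap.comp hG.continuous.measurable
  set K : Set Torus := F₁ '' R with hK
  have hKcl : IsClosed K :=
    ((isClosed_of_mem_dyadicSquares hR).isCompact.image hF₁.continuous).isClosed
  set ν : Measure Torus := Measure.map E (volume.restrict Q') with hν
  have : IsFiniteMeasure ν := by rw [hν]; infer_instance
  have hbound : ∀ ε : ℝ, 0 < ε → ε ≤ 1 / 2 →
      ENNReal.ofReal (ℓ ^ 4 / 256) ≤ ν (Metric.cthickening ε K) := by
    intro ε hε hε'
    have hlow := le_setLIntegral_nearDiagonal hα hN hk hl hF₁ hG hR hQ'mem hε hε'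
    have hup : ∫⁻ w in Q', ∫⁻ z in R, (nearDiagonal ε).indicator 1 (F₁ z, (G w).swap) ≤
        ENNReal.ofReal (4 * ε ^ 2) * ν (Metric.cthickening ε K) := by
      have hT : MeasurableSet (Metric.cthickening ε K) :=
        Metric.isClosed_cthickening.measurableSet
      rw [hν, Measure.map_apply hEm hT, ← lintegral_indicator_const (hEm hT)]
      refine lintegral_mono fun w => ?_
      by_cases hw : w ∈ E ⁻¹' Metric.cthickening ε K
      · rw [indicator_of_mem hw]
        have hball : MeasurableSet (Metric.closedBall (E w) ε) :=
          Metric.isClosed_closedBall.measurableSet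
        calc ∫⁻ z in R, (nearDiagonal ε).indicator 1 (F₁ z, (G w).swap)
            ≤ ∫⁻ z, (nearDiagonal ε).indicator 1 (F₁ z, (G w).swap) := setLIntegral_le_lintegral _ _
          _ = ∫⁻ z, (F₁ ⁻¹' Metric.closedBall (E w) ε).indicator 1 z := rfl
          _ = volume (F₁ ⁻¹' Metric.closedBall (E w) ε) :=
              lintegral_indicator_one (hF₁.continuous.measurable hball)
          _ = volume (Metric.closedBall (E w) ε) :=
              hF₁.measurePreserving.measure_preimage hball.nullMeasurableSet
          _ ≤ _ := volume_closedBall_le _ hε.le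
      · refine le_of_eq_of_le ?_ zero_le
        refine (setLIntegral_congr_fun (g := fun _ => 0)
          (isClosed_of_mem_dyadicSquares hR).measurableSet fun z hz => ?_).trans lintegral_zero
        refine indicator_of_notMem (fun h => hw ?_) _
        refine Metric.mem_cthickening_of_dist_le (E w) (F₁ z) ε K ⟨z, hz, rfl⟩ ?_
        rw [dist_comm]; exact h
    have h4 : ENNReal.ofReal (4 * ε ^ 2) ≠ 0 := by
      rw [Ne, ENNReal.ofReal_eq_zero]; push Not; positivity
    refine (ENNReal.mul_le_mul_iff_right h4 ENNReal.ofReal_ne_top).1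
      (le_trans (le_of_eq ?_) (hlow.trans hup))
    rw [← ENNReal.ofReal_mul (by positivity), ← ENNReal.ofReal_mul (by positivity),
      ← ENNReal.ofReal_mul (by positivity)]
    congr 1; ring
  have hlim : ENNReal.ofReal (ℓ ^ 4 / 256) ≤ ν K := by
    have ht := tendsto_measure_cthickening_of_isClosed (μ := ν) (s := K)
      ⟨1, one_pos, measure_ne_top _ _⟩ hKcl
    refine ge_of_tendsto (ht.mono_left (nhdsWithin_le_nhds (s := Ioi 0))) ?_
    filter_upwards [self_mem_nhdsWithin, mem_nhdsWithin_of_mem_nhds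
      (Iio_mem_nhds (show (0 : ℝ) < 1 / 2 by norm_num))] with ε h1 h2
    exact hbound ε h1 (le_of_lt h2)
  have hKm := hKcl.measurableSet
  have hA : MeasurableSet ((F₂ ∘ F₁) '' R ∩ Q) :=
    (((isClosed_of_mem_dyadicSquares hR).isCompact.image
      (hF₂.continuous.comp hF₁.continuous)).isClosed.inter
        (isClosed_of_mem_dyadicSquares hQ)).measurableSet
  -- If `E w` lies in `K = F₁ '' R`, then `F₂` maps it back to `w.swap`.
  have hfin : ν K ≤ volume ((F₂ ∘ F₁) '' R ∩ Q) := by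
    rw [hν, Measure.map_apply hEm hKm, Measure.restrict_apply (hEm hKm),
      ← measurePreserving_swap_torus.measure_preimage hA.nullMeasurableSet]
    refine measure_mono ?_
    rintro w ⟨hw, q, hq, rfl⟩
    refine ⟨?_, by simpa using hq⟩
    obtain ⟨z, hz, hzw⟩ := hw
    exact ⟨z, hz, by rw [Function.comp_apply, hzw]; exact hinv _⟩
  rw [measureReal_def, ← ENNReal.ofReal_le_iff_le_toReal (measure_ne_top _ _)]
  exact hlim.trans hfin

/-- The same for one long chain, which splits into two halves. For `N = 0` the square is the
whole torus and the chain is surjective. -/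
theorem ShearChain.mul_volumeReal_le {α : ℝ} (hα : 17 ≤ |α|) {N n : ℕ} (hn : 2 * N ≤ n)
    {F : Torus → Torus} (hF : ShearChain α (n + n) F) {R Q : Set Torus}
    (hR : R ∈ dyadicSquares N) (hQ : Q ∈ dyadicSquares N) :
    1 / 256 * volume.real R * volume.real Q ≤ volume.real (F '' R ∩ Q) := by
  have hR1 := volumeReal_le_of_mem_dyadicSquares hR
  have hQ1 := volumeReal_le_of_mem_dyadicSquares hQ
  rcases Nat.eq_zero_or_pos N with rfl | hN
  · obtain ⟨G, -, hinv⟩ := hF.exists_inverse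
    have hsurj : Function.Surjective F := fun z => ⟨(G z.swap).swap, by rw [hinv, Prod.swap_swap]⟩
    rw [eq_univ_of_mem_dyadicSquares_zero hR] at hR1 ⊢
    rw [eq_univ_of_mem_dyadicSquares_zero hQ,
      image_univ_of_surjective hsurj, inter_self]
    have h0 : 0 ≤ volume.real (univ : Set Torus) := measureReal_nonneg
    norm_num at hR1
    nlinarith
  · obtain ⟨F₁, F₂, h₁, h₂, rfl⟩ := hF.exists_comp n n rfl
    refine le_trans ?_ (ShearChain.le_volumeReal_image_inter hα hN hn hn h₁ h₂ hR hQ)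
    have h := mul_le_mul hR1 hQ1 measureReal_nonneg (by positivity)
    nlinarith

lemma shearOne_comp_shearTwo (α : ℝ) (z : Torus) :
    (shearOne α ∘ shearTwo α) z = (halfShear α (halfShear α z.swap)).swap := rfl

lemma shearChain_kickedIterate (α : ℝ) (ξ : ℕ → ℝ × ℝ) (n : ℕ) :
    ShearChain α (n + n) (kickedIterate (shearTwo α ∘ shearOne α) ξ n) := by
  induction n with
  | zero => exact .refl
  | succ n ih =>
    have h := (ih.append (proj (ξ n)) 0).append 0 0
    simp only [add_zero] at h
    rw [show n + 1 + (n + 1) = n + n + 1 + 1 by ring]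
    exact h

lemma exists_shearChain_kickedIterate (α : ℝ) (ξ : ℕ → ℝ × ℝ) (n : ℕ) :
    ∃ F, ShearChain α (n + n) F ∧
      ∀ z, kickedIterate (shearOne α ∘ shearTwo α) ξ n z = (F z.swap).swap := by
  induction n with
  | zero => exact ⟨id, .refl, fun _ => rfl⟩
  | succ n ih =>
    obtain ⟨F, hF, hz⟩ := ih
    have h := (hF.append (proj (ξ n)).swap 0).append 0 0
    simp only [add_zero] at h
    rw [show n + 1 + (n + 1) = n + n + 1 + 1 by ring]
    refine ⟨_, h, fun z => ?_⟩
    rw [kickedIterate, Function.comp_apply, hz, kick, shearOne_comp_shearTwo]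
    rfl

lemma volumeReal_swap_image (A : Set Torus) (hA : MeasurableSet A) :
    volume.real (Prod.swap '' A) = volume.real A := by
  rw [image_swap_eq_preimage_swap]
  exact measurePreserving_swap_torus.measureReal_preimage hA.nullMeasurableSet

end KickedShear

theorem lemma2p1 :
    ∃ C₀ α₀ lam : ℝ, 1 ≤ C₀ ∧ 1 ≤ α₀ ∧ 0 < lam ∧ lam < 1 ∧
      ∀ α : ℤ, Even α → α₀ ≤ (α : ℝ) →
      ∀ T : KickedShear.Torus → KickedShear.Torus,
        T = KickedShear.baseMap α ∨ T = KickedShear.shearTwo α ∘ KickedShear.shearOne α →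
      ∀ (N n : ℕ), C₀ * (N : ℝ) ≤ (n : ℝ) →
      ∀ ξ : ℕ → ℝ × ℝ,
      ∀ R ∈ KickedShear.dyadicSquares N, ∀ Q ∈ KickedShear.dyadicSquares N,
        lam * MeasureTheory.volume.real R * MeasureTheory.volume.real Q ≤
          MeasureTheory.volume.real (KickedShear.kickedIterate T ξ n '' R ∩ Q) := by
  refine ⟨2, 17, 1 / 256, by norm_num, by norm_num, by norm_num, by norm_num, ?_⟩
  intro α _ hα T hT N n hn ξ R hR Q hQ
  have hα' : (17 : ℝ) ≤ |(α : ℝ)| := hα.trans (le_abs_self _)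
  have hn' : 2 * N ≤ n := by exact_mod_cast hn
  rcases hT with rfl | rfl
  · rw [KickedShear.baseMap_eq]
    obtain ⟨F, hF, hz⟩ := KickedShear.exists_shearChain_kickedIterate α ξ n
    have hRc := KickedShear.isClosed_of_mem_dyadicSquares hR
    have hQc := KickedShear.isClosed_of_mem_dyadicSquares hQ
    have hRs := KickedShear.swap_image_mem_dyadicSquares hR
    have hQs := KickedShear.swap_image_mem_dyadicSquares hQ
    have h := hF.mul_volumeReal_le hα' hn' hRs hQs
    have hA : MeasurableSet (F '' (Prod.swap '' R) ∩ Prod.swap '' Q) :=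
      (((KickedShear.isClosed_of_mem_dyadicSquares hRs).isCompact.image
        hF.continuous).isClosed.inter
          (KickedShear.isClosed_of_mem_dyadicSquares hQs)).measurableSet
    rw [KickedShear.volumeReal_swap_image _ hRc.measurableSet,
      KickedShear.volumeReal_swap_image _ hQc.measurableSet,
      ← KickedShear.volumeReal_swap_image _ hA, Set.image_inter Prod.swap_injective,
      Set.image_image, Set.image_image, Set.image_image] at h
    simpa [← hz] using h
  · exact (KickedShear.shearChain_kickedIterate α ξ n).mul_volumeReal_le hα' hn' hR hQ
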